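/- **Setting.** A graph $G=(V,E)$ consists of a finite set $V$ and a multiset $E$ of ordered pairs of elements of $V$ (loops and repeated edges allowed); $b:V\to\mathbb R_{\ge0}$ is a node weight function. Let $\Gamma^+_v(G)$ and $\Gamma^-_v(G)$ be the multisets of outgoing and incoming edges of $v$, let $\deg^+_v(G)=|\Gamma^+_v(G)|$, and let $\#_{(u,v)}(G)$ be the number of edges from $u$ to $v$. Let $dist_{u,v}(G)$ be the least number of edges (at least one) of a path from $u$ to $v$, and $\infty$ if there is no such path. The graph is strongly connected if $V\neq\emptyset$ and for all $u,v\in V$, including $u=v$, there is a path with at least one edge from $u$ to $v$; $\mathcal{SCG}$ is the class of these graphs. Let $A(G)$ be the matrix with entries $A_{v,u}=\#_{(u,v)}(G)$, and let $\lambda(G)$ be its largest real eigenvalue ($\lambda(G)=0$ if $V=\emptyset$). For $a\in(0,1)$ let $\mathcal{KG}^a$ be the class of graphs with $\lambda(G)<1/a$. **Centralities.** On all graphs: - degree centrality: $D_v(G,b)=|\Gamma^-_v(G)|$; - beta measure: $\beta_v(G,b)=\sum_{(u,v)\in\Gamma^-_v(G)}1/\deg^+_u(G)$; - decay centrality, for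 $a\in(0,1)$: $Y^a_v(G,b)=\sum_{u\ne v}a^{dist_{u,v}(G)}$, with $a^\infty=0$; - betweenness centrality: $B_v(G,b)=\sum \sigma_{st}(v)/\sigma_{st}$, summed over ordered pairs of distinct $s,t\in V\setminus\{v\}$ with $\sigma_{st}\ne0$, where $\sigma_{st}$ is the number of shortest paths from $s$ to $t$ (parallel edges give different paths) and $\sigma_{st}(v)$ is the number of those that go through $v$. On $\mathcal{SCG}$: - closeness centrality: $C_v(G,b)=1/\sum_{u\ne v}dist_{u,v}(G)$; - eigenvector centrality: the solution $x$ of $x_v=\frac1{\lambda(G)}\sum_{(u,v)\in\Gamma^-_v(G)}x_u$ $(v\in V)$ with $\sum_v x_v=1$; - Katz prestige: the solution $x$ of $x_v=\sum_{(u,v)\in\Gamma^-_v(G)}x_u/\deg^+_u(G)$ $(v\in V)$ with $\sum_v x_v=1$. On $\mathcal{KG}^a$, for $a\in(0,1)$: - Katz centrality: the solution $x$ of $x_v=a\sum_{(u,v)\in\Gamma^-_v(G)}x_u+b(v)$ $(v\in V)$; - Bonacich centrality: the solution $x$ of $x_v=\sum_{(u,v)\in\Gamma^-_v(G)}(a\,x_u+b(u))$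 $(v\in V)$. **Edge Swap on a class $\mathcal G$**, for a centrality $F$: for every graph $G=(V,E)\in\mathcal G$, node weights $b$, and two edges $(u,u'),(w,w')$ of $G$ (that is, $\{\!|(u,u'),(w,w')|\!\}\subseteq E$ as multisets) with $F_u(G,b)=F_w(G,b)$ and $\deg^+_u(G)=\deg^+_w(G)$, if $G'=(V,\,E-\{\!|(u,u'),(w,w')|\!\}\sqcup\{\!|(u,w'),(w,u')|\!\})\in\mathcal G$, then $F_v(G,b)=F_v(G',b)$ for every $v\in V$. **Proposition (Edge Swap).** 1. The four systems of equations above have exactly one solution on every weighted graph of the stated class, and it is non-negative. 2. Edge Swap is satisfied by degree centrality and beta measure (on all graphs), by eigenvector centrality and Katz prestige (on $\mathcal{SCG}$), and by Katz centrality (on $\mathcal{KG}^a$, for every $a\in(0,1)$). 3. Edge Swap is not satisfied by Bonacich centrality (on $\mathcal{KG}^a$, for every $a\in(0,1)$), closeness centrality (on $\mathcal{SCG}$), decay centrality (on all graphs, for every $a\in(0,1)$) and betweenness centrality (on all graphs). 4. If $G\in\mathcal{SCG}$ and $A(G)x=cx$ with $c\in\mathbb R$ and $x_v>0$ for all $v$,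 then $c=\lambda(G)$. In particular, whenever $G,G'\in\mathcal{SCG}$ are as in Edge Swap for eigenvector centrality, $\lambda(G)=\lambda(G')$. -/

import Mathlib

open scoped NNReal Matrix

universe u

/-- A finite directed multigraph on the node set `V`: a multiset of ordered pairs of nodes.
Loops and repeated edges are allowed. -/
structure DirMultigraph (V : Type u) where
  edges : Multiset (V × V)

namespace DirMultigraph

section Basic

variable {V : Type u} [DecidableEq V]

/-- The multiset of outgoing edges of `v`. -/
def outEdges (G : DirMultigraph V) (v : V) : Multiset (V × V) :=
  G.edges.filter fun e => e.1 = v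

/-- The multiset of incoming edges of `v`. -/
def inEdges (G : DirMultigraph V) (v : V) : Multiset (V × V) :=
  G.edges.filter fun e => e.2 = v

/-- The out-degree of `v`, with multiplicity. -/
def outDegree (G : DirMultigraph V) (v : V) : ℕ :=
  (G.outEdges v).card

/-- The number of edges from `u` to `v`. -/
def mult (G : DirMultigraph V) (u v : V) : ℕ :=
  G.edges.count (u, v)

/-- Swapping the ends of the edges `(u, u')` and `(w, w')`. -/
def swap (G : DirMultigraph V) (u u' w w' : V) : DirMultigraph V :=
  ⟨G.edges - {(u, u'), (w, w')} + {(u, w'), (w, u')}⟩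

/-- There is a path with `n` edges from `u` to `v`. -/
def HasPath (G : DirMultigraph V) (n : ℕ) (u v : V) : Prop :=
  ∃ p : Fin (n + 1) → V, p 0 = u ∧ p (Fin.last n) = v ∧
    ∀ i : Fin n, (p i.castSucc, p i.succ) ∈ G.edges

/-- `v` is a successor of `u`: there is a path with at least one edge from `u` to `v`. -/
def IsSuccessor (G : DirMultigraph V) (u v : V) : Prop :=
  ∃ n : ℕ, 1 ≤ n ∧ G.HasPath n u v

/-- The distance from `u` to `v`: the least length of a path with at least one edge
from `u` to `v`, and `⊤` if there is no such path. -/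
noncomputable def dist (G : DirMultigraph V) (u v : V) : ℕ∞ :=
  sInf {d : ℕ∞ | ∃ n : ℕ, 1 ≤ n ∧ G.HasPath n u v ∧ d = (n : ℕ∞)}

variable [Fintype V]

/-- Strongly connected: the graph has a node, and every node is a successor of every node
(itself included, so an isolated node is not a strongly connected graph). -/
def StronglyConnected (G : DirMultigraph V) : Prop :=
  Nonempty V ∧ ∀ u v : V, G.IsSuccessor u v

/-- The adjacency matrix with `(v, u)` entry the number of edges from `u` to `v`. -/
def adjMatrix (G : DirMultigraph V) : Matrix V V ℝ :=
  Matrix.of fun v u => (G.mult u v : ℝ)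

/-- The largest real eigenvalue of the adjacency matrix. -/
noncomputable def lam (G : DirMultigraph V) : ℝ :=
  sSup {c : ℝ | ∃ x : V → ℝ, x ≠ 0 ∧ G.adjMatrix *ᵥ x = c • x}

/-- The number of paths with `n` edges from `s` to `t`; parallel edges give different paths, so
a node sequence is counted with the product of the multiplicities of its steps. -/
def numPaths (G : DirMultigraph V) (n : ℕ) (s t : V) : ℕ :=
  ∑ p : Fin (n + 1) → V, if p 0 = s ∧ p (Fin.last n) = t then
    ∏ i : Fin n, G.mult (p i.castSucc) (p i.succ) else 0

/-- The number of those paths with `n` edges from `s` to `t` that go through `v`. -/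
def numPathsThrough (G : DirMultigraph V) (n : ℕ) (s t v : V) : ℕ :=
  ∑ p : Fin (n + 1) → V, if p 0 = s ∧ p (Fin.last n) = t ∧ ∃ i, p i = v then
    ∏ i : Fin n, G.mult (p i.castSucc) (p i.succ) else 0

open Classical in
/-- The number of shortest paths from `s` to `t`. -/
noncomputable def numShortestPaths (G : DirMultigraph V) (s t : V) : ℕ :=
  if G.dist s t = ⊤ then 0 else G.numPaths (G.dist s t).toNat s t

open Classical in
/-- The number of shortest paths from `s` to `t` that go through `v`. -/
noncomputable def numShortestPathsThrough (G : DirMultigraph V) (s t v : V) : ℕ :=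
  if G.dist s t = ⊤ then 0 else G.numPathsThrough (G.dist s t).toNat s t v

end Basic

/-- A class of finite graphs. -/
abbrev GraphClass : Type (u + 1) :=
  ∀ (V : Type u) [Fintype V] [DecidableEq V], DirMultigraph V → Prop

/-- A real-valued function of graphs, non-negative node weights and nodes. -/
abbrev Centrality : Type (u + 1) :=
  ∀ (V : Type u) [Fintype V] [DecidableEq V], DirMultigraph V → (V → ℝ≥0) → V → ℝ

/-- A condition (system of equations) on a vector `x`, for every weighted graph. -/
abbrev CentralitySystem : Type (u + 1) :=
  ∀ (V : Type u) [Fintype V] [DecidableEq V], DirMultigraph V → (V → ℝ≥0) → (V → ℝ) → Prop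

/-- All graphs. -/
def allGraphs : GraphClass.{u} := fun _ _ _ _ => True

/-- Strongly connected graphs. -/
def scGraphs : GraphClass.{u} := fun _ _ _ G => G.StronglyConnected

/-- Graphs whose largest eigenvalue is less than `1 / a`. -/
def katzGraphs (a : ℝ) : GraphClass.{u} := fun _ _ _ G => G.lam < 1 / a

/-- The system has, on every weighted graph of the class, exactly one solution, and this
solution is non-negative. -/
def DefinesCentralityOn (C : GraphClass.{u}) (S : CentralitySystem.{u}) : Prop :=
  ∀ (V : Type u) [Fintype V] [DecidableEq V] (G : DirMultigraph V) (b : V → ℝ≥0),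
    C V G → (∃! x : V → ℝ, S V G b x) ∧ ∀ x : V → ℝ, S V G b x → ∀ v, 0 ≤ x v

/-- The centrality whose values are the solution of the system. -/
noncomputable def CentralitySystem.solution (S : CentralitySystem.{u}) : Centrality.{u} :=
  fun V _ _ G b => Classical.epsilon fun x : V → ℝ => S V G b x

/-- Edge Swap restricted to the class `C`. The multiset inequality says that `(u, u')` and
`(w, w')` are two edges of the graph (two copies of one edge if they are equal as pairs). -/
def EdgeSwapOn (C : GraphClass.{u}) (F : Centrality.{u}) : Prop :=
  ∀ (V : Type u) [Fintype V] [DecidableEq V] (G : DirMultigraph V) (b : V → ℝ≥0)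
    (u u' w w' : V),
    C V G → ({(u, u'), (w, w')} : Multiset (V × V)) ≤ G.edges →
    F V G b u = F V G b w → G.outDegree u = G.outDegree w →
    C V (G.swap u u' w w') →
    ∀ v : V, F V G b v = F V (G.swap u u' w w') b v

/-- Degree centrality. -/
def degreeCentrality : Centrality.{u} := fun _ _ _ G _ v =>
  ((G.inEdges v).card : ℝ)

/-- Beta measure. -/
noncomputable def betaMeasure : Centrality.{u} := fun _ _ _ G _ v =>
  ((G.inEdges v).map fun e => 1 / (G.outDegree e.1 : ℝ)).sum

/-- Eigenvector equations, normalized to total `1`. -/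
def eigenvectorSystem : CentralitySystem.{u} := fun _ _ _ G _ x =>
  (∀ v, x v = 1 / G.lam * ((G.inEdges v).map fun e => x e.1).sum) ∧ ∑ v, x v = 1

/-- Katz prestige equations, normalized to total `1`. -/
def katzPrestigeSystem : CentralitySystem.{u} := fun _ _ _ G _ x =>
  (∀ v, x v = ((G.inEdges v).map fun e => x e.1 / (G.outDegree e.1 : ℝ)).sum) ∧ ∑ v, x v = 1

/-- Katz equations with decay factor `a`. -/
def katzSystem (a : ℝ) : CentralitySystem.{u} := fun _ _ _ G b x =>
  ∀ v, x v = a * ((G.inEdges v).map fun e => x e.1).sum + (b v : ℝ)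

/-- Bonacich equations with decay factor `a`. -/
def bonacichSystem (a : ℝ) : CentralitySystem.{u} := fun _ _ _ G b x =>
  ∀ v, x v = ((G.inEdges v).map fun e => a * x e.1 + (b e.1 : ℝ)).sum

/-- Eigenvector centrality. -/
noncomputable def eigenvectorCentrality : Centrality.{u} := eigenvectorSystem.solution

/-- Katz prestige. -/
noncomputable def katzPrestige : Centrality.{u} := katzPrestigeSystem.solution

/-- Katz centrality. -/
noncomputable def katzCentrality (a : ℝ) : Centrality.{u} := (katzSystem a).solution

/-- Bonacich centrality. -/
noncomputable def bonacichCentrality (a : ℝ) : Centrality.{u} := (bonacichSystem a).solution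

/-- Closeness centrality. -/
noncomputable def closenessCentrality : Centrality.{u} := fun _ _ _ G _ v =>
  1 / ∑ u ∈ Finset.univ.erase v, ((G.dist u v).toNat : ℝ)

open Classical in
/-- Decay centrality with decay factor `a`; unreachable pairs contribute `0`. -/
noncomputable def decayCentrality (a : ℝ) : Centrality.{u} := fun _ _ _ G _ v =>
  ∑ u ∈ Finset.univ.erase v, if G.dist u v = ⊤ then 0 else a ^ (G.dist u v).toNat

/-- Betweenness centrality: sum over ordered pairs of distinct nodes different from `v`. -/
noncomputable def betweennessCentrality : Centrality.{u} := fun _ _ _ G _ v =>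
  ∑ s ∈ Finset.univ.erase v, ∑ t ∈ (Finset.univ.erase v).erase s,
    if G.numShortestPaths s t ≠ 0 then
      (G.numShortestPathsThrough s t v : ℝ) / (G.numShortestPaths s t : ℝ)
    else 0

end DirMultigraph

/-! ### Nonnegative matrices and strict supersolutions -/

namespace Matrix

variable {V : Type u} [Fintype V] {A : Matrix V V ℝ}

/-! Existence and uniqueness rest on a Perron–Frobenius theory built from strict supersolutions:
positive `x` with `A x < s x`. Such an `x` gives a minimum principle for `s - A`
(`HasStrictSupersolution.nonneg`), so `s - A` is invertible with nonnegative inverse. The infimum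
`r` of all such `s` is an eigenvalue with a nonnegative eigenvector (`exists_nonneg_eigenvector`),
and no real eigenvalue exceeds it; on nonempty graphs `r` is `lam`. Strong connectivity makes the
eigenvector positive and unique up to scale. This settles eigenvector centrality and Katz prestige,
while `lam < 1 / a` makes `1 / a` admissible for the Katz and Bonacich systems.

A swap replaces, at each target, an incoming edge from `u` by one from `w` or conversely. Sums over
incoming edges of a quantity that agrees at `u` and `w` therefore do not change
(`sum_inEdges_swap`). The old solution then solves the new system, and uniqueness finishes. In the
eigenvector case the old positive eigenvector also fixes the new `lam`.

Bonacich centrality sends `b u` along edges, and `b` may differ at `u` and `w`; the other failures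
come from changed distances or shortest paths. Small explicit graphs show each. -/

theorem mulVec_le_mulVec_of_nonneg (hA : ∀ i j, 0 ≤ A i j) {x y : V → ℝ} (h : ∀ i, x i ≤ y i)
    (i : V) : (A *ᵥ x) i ≤ (A *ᵥ y) i :=
  Finset.sum_le_sum fun j _ => mul_le_mul_of_nonneg_left (h j) (hA i j)

theorem mulVec_nonneg_of_nonneg (hA : ∀ i j, 0 ≤ A i j) {x : V → ℝ} (h : ∀ i, 0 ≤ x i)
    (i : V) : 0 ≤ (A *ᵥ x) i :=
  Finset.sum_nonneg fun j _ => mul_nonneg (hA i j) (h j)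

/-- `A` has a positive vector which it contracts strictly by the factor `s`. -/
def HasStrictSupersolution (A : Matrix V V ℝ) (s : ℝ) : Prop :=
  ∃ x : V → ℝ, (∀ i, 0 < x i) ∧ ∀ i, (A *ᵥ x) i < s * x i

theorem HasStrictSupersolution.mono {s t : ℝ} (h : A.HasStrictSupersolution s) (hst : s ≤ t) :
    A.HasStrictSupersolution t := by
  obtain ⟨x, hx, hs⟩ := h
  exact ⟨x, hx, fun i => (hs i).trans_le (mul_le_mul_of_nonneg_right hst (hx i).le)⟩

theorem HasStrictSupersolution.pos [Nonempty V] (hA : ∀ i j, 0 ≤ A i j) {s : ℝ}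
    (h : A.HasStrictSupersolution s) : 0 < s := by
  obtain ⟨x, hx, hs⟩ := h
  let i : V := Classical.arbitrary V
  exact pos_of_mul_pos_left
    ((mulVec_nonneg_of_nonneg hA (fun j => (hx j).le) i).trans_lt (hs i)) (hx i).le

theorem exists_hasStrictSupersolution (A : Matrix V V ℝ) : ∃ s, A.HasStrictSupersolution s := by
  refine ⟨1 + ∑ i, |(A *ᵥ fun _ => 1) i|, fun _ => 1, fun _ => one_pos, fun i => ?_⟩
  have h := Finset.single_le_sum (f := fun i => |(A *ᵥ fun _ => 1) i|)
    (fun i _ => abs_nonneg _) (Finset.mem_univ i)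
  have h' := le_abs_self ((A *ᵥ fun _ => 1) i)
  linarith

/-- By finiteness the largest ratio `(A x) i / x i` is attained, hence still below `s`. Thus the set
of admissible `s` has no least element. -/
theorem HasStrictSupersolution.exists_lt {s : ℝ} (h : A.HasStrictSupersolution s) :
    ∃ t < s, A.HasStrictSupersolution t := by
  obtain ⟨x, hx, hs⟩ := h
  rcases isEmpty_or_nonempty V with hV | hV
  · exact ⟨s - 1, by linarith, x, hx, fun i => hV.elim i⟩
  obtain ⟨i, hi⟩ := Finite.exists_max fun i => (A *ᵥ x) i / x i
  have h1 : (A *ᵥ x) i / x i < s := (div_lt_iff₀ (hx i)).2 (hs i)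
  obtain ⟨t, ht, hts⟩ := exists_between h1
  exact ⟨t, hts, x, hx, fun j => (div_lt_iff₀ (hx j)).1 ((hi j).trans_lt ht)⟩

/-- The minimum principle for `s - A`. -/
theorem HasStrictSupersolution.nonneg (hA : ∀ i j, 0 ≤ A i j) {s : ℝ}
    (h : A.HasStrictSupersolution s) {y : V → ℝ} (hy : ∀ i, (A *ᵥ y) i ≤ s * y i) (j : V) :
    0 ≤ y j := by
  obtain ⟨x, hx, hs⟩ := h
  have : Nonempty V := ⟨j⟩
  -- If the least ratio `m = y i / x i` is negative, then `y ≥ m x` gives `(A y) i ≥ m (A x) i > m s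
  -- x i = s y i`, against `hy`.
  obtain ⟨i, hi⟩ := Finite.exists_min fun i => y i / x i
  by_contra! hj
  have hm : y i / x i < 0 := (hi j).trans_lt (div_neg_of_neg_of_pos hj (hx j))
  have h1 := mulVec_le_mulVec_of_nonneg hA (x := (y i / x i) • x) (y := y)
    (fun k => by simpa using (le_div_iff₀ (hx k)).1 (hi k)) i
  rw [Matrix.mulVec_smul, Pi.smul_apply, smul_eq_mul] at h1
  have h2 := mul_lt_mul_of_neg_left (hs i) hm
  have h3 : y i / x i * (s * x i) = s * y i := by
    have := (hx i).ne'
    field_simp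
  linarith [hy i]

/-- The minimum principle applies to both `y` and `-y`. -/
theorem HasStrictSupersolution.eq_zero (hA : ∀ i j, 0 ≤ A i j) {s : ℝ}
    (h : A.HasStrictSupersolution s) {y : V → ℝ} (hy : A *ᵥ y = s • y) : y = 0 := by
  ext j
  refine le_antisymm ?_ (h.nonneg hA (fun i => by simp [hy]) j)
  have := h.nonneg hA (y := -y) (fun i => by simp [Matrix.mulVec_neg, hy]) j
  simpa using this

theorem HasStrictSupersolution.existsUnique (hA : ∀ i j, 0 ≤ A i j) {s : ℝ}
    (h : A.HasStrictSupersolution s) (b : V → ℝ) : ∃! y : V → ℝ, s • y = A *ᵥ y + b := by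
  let f : (V → ℝ) →ₗ[ℝ] (V → ℝ) := s • LinearMap.id - A.mulVecLin
  have hf : ∀ y, f y = s • y - A *ᵥ y := fun y => by simp [f]
  have hinj : Function.Injective f := by
    rw [← LinearMap.ker_eq_bot, LinearMap.ker_eq_bot']
    intro y hy
    rw [hf, sub_eq_zero] at hy
    exact h.eq_zero hA hy.symm
  obtain ⟨y, hy⟩ := LinearMap.injective_iff_surjective.1 hinj b
  have key : ∀ z, s • z = A *ᵥ z + b ↔ f z = b := fun z => by
    rw [hf, sub_eq_iff_eq_add']
  exact ⟨y, (key y).2 hy, fun z hz => hinj (((key z).1 hz).trans hy.symm)⟩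

open Filter Topology in
/-- A nonnegative matrix has a nonnegative eigenvector, whose eigenvalue bounds the others. -/
theorem exists_nonneg_eigenvector [Nonempty V] (hA : ∀ i j, 0 ≤ A i j) :
    ∃ (r : ℝ) (y : V → ℝ), (∀ i, 0 ≤ y i) ∧ ∑ i, y i = 1 ∧ A *ᵥ y = r • y ∧
      ∀ s, r < s → A.HasStrictSupersolution s := by
  set S : Set ℝ := {s | A.HasStrictSupersolution s} with hS
  have hne : S.Nonempty := A.exists_hasStrictSupersolution
  have hbdd : BddBelow S := ⟨0, fun s hs => (HasStrictSupersolution.pos hA hs).le⟩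
  set r := sInf S with hr
  have hgt : ∀ s, r < s → A.HasStrictSupersolution s := fun s hs => by
    obtain ⟨t, ht, hts⟩ := (csInf_lt_iff hbdd hne).1 hs
    exact HasStrictSupersolution.mono ht hts.le
  -- Solve `(s - A) x = 1` for `s` slightly above `r` and scale `x` into the simplex; the right side
  -- becomes a positive constant `τ`. Compactness then gives a limit `z` with `r z - A z` a constant
  -- `t ≥ 0`.
  have hseq : ∀ n : ℕ, ∃ y ∈ stdSimplex ℝ V, ∃ τ : ℝ, 0 < τ ∧
      ∀ i, (r + 1 / ((n : ℝ) + 1)) * y i - (A *ᵥ y) i = τ := fun n => by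
    have hs := hgt (r + 1 / ((n : ℝ) + 1)) (by simpa using by positivity)
    obtain ⟨x, hx, -⟩ := hs.existsUnique hA fun _ => 1
    have hx' : ∀ i, (r + 1 / ((n : ℝ) + 1)) * x i = (A *ᵥ x) i + 1 := fun i => by
      simpa using congrFun hx i
    have h0 : ∀ i, 0 ≤ x i := hs.nonneg hA fun i => by linarith [hx' i]
    have hsum : 0 < ∑ i, x i := by
      refine (Finset.sum_nonneg fun i _ => h0 i).lt_of_ne' fun h => ?_
      have hz : x = 0 := by
        ext i
        exact (Finset.sum_eq_zero_iff_of_nonneg fun i _ => h0 i).1 h i (Finset.mem_univ i)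
      have := hx' (Classical.arbitrary V)
      simp [hz] at this
    refine ⟨(∑ i, x i)⁻¹ • x, ⟨fun i => ?_, ?_⟩, (∑ i, x i)⁻¹, inv_pos.2 hsum, fun i => ?_⟩
    · exact mul_nonneg (inv_pos.2 hsum).le (h0 i)
    · simp only [Pi.smul_apply, smul_eq_mul, ← Finset.mul_sum]
      exact inv_mul_cancel₀ hsum.ne'
    · simp only [Matrix.mulVec_smul, Pi.smul_apply, smul_eq_mul]
      linear_combination (∑ i, x i)⁻¹ * hx' i
  choose y hy τ hτ hyτ using hseq
  obtain ⟨z, hz, φ, hφ, hlim⟩ := (isCompact_stdSimplex ℝ V).tendsto_subseq hy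
  have hlimi : ∀ i, Tendsto (fun n => τ (φ n)) atTop (𝓝 (r * z i - (A *ᵥ z) i)) := fun i => by
    have h1 : Tendsto (fun n => r + 1 / ((φ n : ℝ) + 1)) atTop (𝓝 (r + 0)) :=
      (tendsto_one_div_add_atTop_nhds_zero_nat.comp hφ.tendsto_atTop).const_add r
    have h2 : Tendsto (fun n => y (φ n) i) atTop (𝓝 (z i)) := (tendsto_pi_nhds.1 hlim) i
    have h3 : Tendsto (fun n => (A *ᵥ y (φ n)) i) atTop (𝓝 ((A *ᵥ z) i)) := by
      have hc : Continuous fun x : V → ℝ => (A *ᵥ x) i := by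
        simp only [Matrix.mulVec, dotProduct]
        fun_prop
      exact (hc.tendsto z).comp hlim
    have h4 := (h1.mul h2).sub h3
    rw [add_zero] at h4
    exact h4.congr fun n => hyτ (φ n) i
  let i₀ : V := Classical.arbitrary V
  set t := r * z i₀ - (A *ᵥ z) i₀ with ht
  have hti : ∀ i, r * z i - (A *ᵥ z) i = t := fun i =>
    tendsto_nhds_unique (hlimi i) (hlimi i₀)
  have ht0 : 0 ≤ t := ge_of_tendsto' (hlimi i₀) fun n => (hτ _).le
  have hr0 : 0 ≤ r := le_csInf hne fun s hs => (HasStrictSupersolution.pos hA hs).le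
  -- If `t > 0`, then `z` is positive and a strict supersolution at `r` itself, so some smaller `s`
  -- is admissible, against the choice of `r`.
  have htz : t = 0 := by
    by_contra hne0
    have htp : 0 < t := ht0.lt_of_ne' hne0
    have hpos : ∀ i, 0 < z i := fun i => by
      have h1 := mulVec_nonneg_of_nonneg hA hz.1 i
      have h2 : 0 < r * z i := by linarith [hti i]
      exact pos_of_mul_pos_right h2 hr0
    obtain ⟨s, hsr, hs⟩ := HasStrictSupersolution.exists_lt (A := A) (s := r)
      ⟨z, hpos, fun i => by linarith [hti i]⟩
    exact hsr.not_ge (csInf_le hbdd hs)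
  refine ⟨r, z, hz.1, hz.2, ?_, hgt⟩
  ext i
  simp only [Pi.smul_apply, smul_eq_mul]
  linarith [hti i]

end Matrix

/-! ### Perron–Frobenius on strongly connected graphs -/

namespace DirMultigraph

variable {V : Type u}

theorem StronglyConnected.exists_edge [Fintype V] {G : DirMultigraph V}
    (hG : G.StronglyConnected) (u : V) : ∃ v, (u, v) ∈ G.edges := by
  obtain ⟨n, hn, p, h0, -, hp⟩ := hG.2 u u
  refine ⟨p (Fin.succ ⟨0, hn⟩), ?_⟩
  have := hp ⟨0, hn⟩
  rwa [show Fin.castSucc (⟨0, hn⟩ : Fin n) = 0 from rfl, h0] at this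

/-- Positivity spreads along an edge `(u, v)`, since `r * y v ≥ M v u * y u > 0`, which also forces
`r > 0`. Paths carry it to every node. -/
theorem StronglyConnected.eigenvector_pos [Fintype V] {G : DirMultigraph V}
    {M : Matrix V V ℝ} (hG : G.StronglyConnected) (hM : ∀ i j, 0 ≤ M i j)
    (hE : ∀ u v, (u, v) ∈ G.edges → 0 < M v u) {y : V → ℝ} (hy : ∀ v, 0 ≤ y v) (hy0 : y ≠ 0)
    {r : ℝ} (hr : M *ᵥ y = r • y) : 0 < r ∧ ∀ v, 0 < y v := by
  have step : ∀ u v, (u, v) ∈ G.edges → 0 < y u → 0 < r ∧ 0 < y v := fun u v huv hu => by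
    have h1 : M v u * y u ≤ (M *ᵥ y) v :=
      Finset.single_le_sum (f := fun u => M v u * y u)
        (fun j _ => mul_nonneg (hM v j) (hy j)) (Finset.mem_univ u)
    have h2 : 0 < r * y v := by
      have := congrFun hr v
      simp only [Pi.smul_apply, smul_eq_mul] at this
      exact this ▸ (mul_pos (hE u v huv) hu).trans_le h1
    have h3 : 0 < r := pos_of_mul_pos_left h2 (hy v)
    exact ⟨h3, pos_of_mul_pos_right h2 h3.le⟩
  obtain ⟨u, hu⟩ := Function.ne_iff.1 hy0
  have hu : 0 < y u := (hy u).lt_of_ne' hu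
  obtain ⟨v, huv⟩ := hG.exists_edge u
  refine ⟨(step u v huv hu).1, fun w => ?_⟩
  obtain ⟨n, -, p, h0, h1, hp⟩ := hG.2 u w
  have : ∀ i, 0 < y (p i) := fun i => by
    induction i using Fin.induction with
    | zero => rwa [h0]
    | succ i ih => exact (step _ _ (hp i) ih).2
  exact h1 ▸ this _

/-- The Perron–Frobenius theorem for a matrix supported on a strongly connected graph. -/
theorem StronglyConnected.perronFrobenius [Fintype V] {G : DirMultigraph V}
    {M : Matrix V V ℝ} (hG : G.StronglyConnected) (hM : ∀ i j, 0 ≤ M i j)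
    (hE : ∀ u v, (u, v) ∈ G.edges → 0 < M v u) :
    ∃ (r : ℝ) (y : V → ℝ), 0 < r ∧ (∀ v, 0 < y v) ∧ ∑ v, y v = 1 ∧ M *ᵥ y = r • y ∧
      (∀ c x, x ≠ 0 → M *ᵥ x = c • x → c ≤ r) ∧
      ∀ x, ∑ v, x v = 1 → M *ᵥ x = r • x → x = y := by
  have hV := hG.1
  obtain ⟨r, y, hy, hsum, hr, hgt⟩ := Matrix.exists_nonneg_eigenvector hM
  have hy0 : y ≠ 0 := by
    rintro rfl
    simp at hsum
  obtain ⟨hr0, hpos⟩ := hG.eigenvector_pos hM hE hy hy0 hr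
  refine ⟨r, y, hr0, hpos, hsum, hr, fun c x hx hc => ?_, fun x hx1 hx => ?_⟩
  · by_contra! h
    exact hx ((hgt c h).eq_zero hM hc)
  -- Subtract from `x` the largest multiple of `y` that leaves it nonnegative. The difference
  -- vanishes at `i`, so it cannot be a nonzero eigenvector; the normalization then gives `m = 1`.
  · obtain ⟨i, hi⟩ := Finite.exists_min fun i => x i / y i
    set m := x i / y i with hm
    have hz : x - m • y = 0 := by
      by_contra hne
      have := (hG.eigenvector_pos hM hE (y := x - m • y) (r := r) (fun k => ?_) hne ?_).2 i
      · simp [hm, div_mul_cancel₀ _ (hpos i).ne'] at this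
      · simpa using (le_div_iff₀ (hpos k)).1 (hi k)
      · rw [Matrix.mulVec_sub, Matrix.mulVec_smul, hr, hx, smul_sub, smul_comm]
    rw [sub_eq_zero] at hz
    have hm1 : m = 1 := by
      rw [hz] at hx1
      simpa [← Finset.mul_sum, hsum] using hx1
    rw [hz, hm1, one_smul]

/-! ### Edge sums in matrix form -/

variable [DecidableEq V]

theorem sum_inEdges [Fintype V] (G : DirMultigraph V) (f : V → ℝ) (v : V) :
    ((G.inEdges v).map fun e => f e.1).sum = ∑ u, (G.mult u v : ℝ) * f u := by
  obtain ⟨E⟩ := G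
  simp only [inEdges, mult]
  induction E using Multiset.induction with
  | empty => simp
  | cons e E ih =>
    obtain ⟨p, q⟩ := e
    rw [Multiset.filter_cons]
    simp only [Multiset.map_add, Multiset.sum_add, ih, Multiset.count_cons, Prod.mk.injEq,
      Nat.cast_add, add_mul, Finset.sum_add_distrib]
    rw [add_comm]
    congr 1
    by_cases h : q = v
    · simp [h, eq_comm]
    · simp [h, Ne.symm h]

theorem sum_mult [Fintype V] (G : DirMultigraph V) (u : V) :
    ∑ v, G.mult u v = G.outDegree u := by
  obtain ⟨E⟩ := G
  simp only [outDegree, outEdges, mult]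
  induction E using Multiset.induction with
  | empty => simp
  | cons e E ih =>
    obtain ⟨p, q⟩ := e
    rw [Multiset.filter_cons]
    simp only [Multiset.card_add, ← ih, Multiset.count_cons, Prod.mk.injEq,
      Finset.sum_add_distrib]
    rw [add_comm]
    congr 1
    by_cases h : p = u
    · simp [h]
    · simp [h, Ne.symm h]

theorem adjMatrix_mulVec [Fintype V] (G : DirMultigraph V) (x : V → ℝ) (v : V) :
    (G.adjMatrix *ᵥ x) v = ((G.inEdges v).map fun e => x e.1).sum := by
  rw [sum_inEdges]
  rfl

theorem adjMatrix_nonneg [Fintype V] (G : DirMultigraph V) (v u : V) : 0 ≤ G.adjMatrix v u :=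
  Nat.cast_nonneg _

theorem adjMatrix_pos [Fintype V] (G : DirMultigraph V) {u v : V} (h : (u, v) ∈ G.edges) :
    0 < G.adjMatrix v u :=
  Nat.cast_pos.2 (Multiset.count_pos.2 h)

theorem outDegree_pos_of_mem {G : DirMultigraph V} {u v : V} (h : (u, v) ∈ G.edges) :
    0 < G.outDegree u :=
  Multiset.card_pos_iff_exists_mem.2 ⟨(u, v), Multiset.mem_filter.2 ⟨h, rfl⟩⟩

/-! ### The largest eigenvalue -/

section LargestEigenvalue

variable [Fintype V] {G : DirMultigraph V}

theorem lam_eq_of_isGreatest {r : ℝ} {y : V → ℝ} (hy : y ≠ 0) (hr : G.adjMatrix *ᵥ y = r • y)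
    (hmax : ∀ c x, x ≠ 0 → G.adjMatrix *ᵥ x = c • x → c ≤ r) : G.lam = r :=
  IsGreatest.csSup_eq ⟨⟨y, hy, hr⟩, fun c ⟨x, hx, hc⟩ => hmax c x hx hc⟩

theorem StronglyConnected.lam_spec (hG : G.StronglyConnected) :
    ∃ y : V → ℝ, 0 < G.lam ∧ (∀ v, 0 < y v) ∧ ∑ v, y v = 1 ∧ G.adjMatrix *ᵥ y = G.lam • y ∧
      (∀ c x, x ≠ 0 → G.adjMatrix *ᵥ x = c • x → c ≤ G.lam) ∧
      ∀ x, ∑ v, x v = 1 → G.adjMatrix *ᵥ x = G.lam • x → x = y := by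
  obtain ⟨r, y, hr0, hpos, hsum, hr, hmax, huniq⟩ :=
    hG.perronFrobenius G.adjMatrix_nonneg fun _ _ => G.adjMatrix_pos
  have hy0 : y ≠ 0 := by
    rintro rfl
    simp at hsum
  obtain rfl := lam_eq_of_isGreatest hy0 hr hmax
  exact ⟨y, hr0, hpos, hsum, hr, hmax, huniq⟩

/-- A positive eigenvector belongs to the largest eigenvalue. -/
theorem StronglyConnected.lam_eq (hG : G.StronglyConnected) {c : ℝ} {x : V → ℝ}
    (hx : ∀ v, 0 < x v) (hc : G.adjMatrix *ᵥ x = c • x) : G.lam = c := by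
  have hV := hG.1
  obtain ⟨y, -, hpos, hsum, hr, hmax, -⟩ := hG.lam_spec
  have hx0 : x ≠ 0 := fun h => (hx (Classical.arbitrary V)).ne' (congrFun h _)
  have hy0 : y ≠ 0 := fun h => (hpos (Classical.arbitrary V)).ne' (congrFun h _)
  -- If `c < G.lam`, then `x` is a strict supersolution at `G.lam`, which therefore has no nonzero
  -- eigenvector.
  refine le_antisymm (not_lt.1 fun h => hy0 ?_) (hmax c x hx0 hc)
  refine Matrix.HasStrictSupersolution.eq_zero G.adjMatrix_nonneg ⟨x, hx, fun i => ?_⟩ hr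
  rw [hc]
  exact mul_lt_mul_of_pos_right h (hx i)

/-- The infimum of the admissible values is an eigenvalue bounding all others, hence equals `lam`.
This makes the condition defining `katzGraphs` usable. -/
theorem hasStrictSupersolution_of_lam_lt {s : ℝ} (h : G.lam < s) :
    G.adjMatrix.HasStrictSupersolution s := by
  rcases isEmpty_or_nonempty V with hV | hV
  · exact ⟨0, fun i => hV.elim i, fun i => hV.elim i⟩
  obtain ⟨r, y, -, hsum, hr, hgt⟩ := Matrix.exists_nonneg_eigenvector G.adjMatrix_nonneg
  have hy0 : y ≠ 0 := by
    rintro rfl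
    simp at hsum
  rw [lam_eq_of_isGreatest hy0 hr fun c x hx hc => ?_] at h
  · exact hgt s h
  · by_contra! h
    exact hx ((hgt c h).eq_zero G.adjMatrix_nonneg hc)

end LargestEigenvalue

/-! ### Well-posedness of the four systems -/

section Systems

theorem eigenvectorSystem_iff [Fintype V] {G : DirMultigraph V} (hG : G.StronglyConnected)
    {b : V → ℝ≥0} {x : V → ℝ} :
    eigenvectorSystem V G b x ↔ ∑ v, x v = 1 ∧ G.adjMatrix *ᵥ x = G.lam • x := by
  obtain ⟨-, hl, -⟩ := hG.lam_spec
  rw [eigenvectorSystem, and_comm, funext_iff]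
  refine and_congr_right fun _ => forall_congr' fun v => ?_
  rw [adjMatrix_mulVec, Pi.smul_apply, smul_eq_mul, one_div, eq_inv_mul_iff_mul_eq₀ hl.ne', eq_comm]

theorem definesCentralityOn_eigenvectorSystem :
    DefinesCentralityOn.{u} scGraphs eigenvectorSystem := by
  intro V _ _ G b hG
  obtain ⟨y, -, hpos, hsum, hr, -, huniq⟩ := StronglyConnected.lam_spec hG
  simp only [eigenvectorSystem_iff hG]
  refine ⟨⟨y, ⟨hsum, hr⟩, fun x hx => huniq x hx.1 hx.2⟩, fun x hx v => ?_⟩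
  rw [huniq x hx.1 hx.2]
  exact (hpos v).le

/-- The transition matrix of the random walk on the graph. -/
noncomputable def walkMatrix [Fintype V] (G : DirMultigraph V) : Matrix V V ℝ :=
  Matrix.of fun v u => (G.mult u v : ℝ) / G.outDegree u

theorem walkMatrix_mulVec [Fintype V] (G : DirMultigraph V) (x : V → ℝ) (v : V) :
    (G.walkMatrix *ᵥ x) v =
      ((G.inEdges v).map fun e => x e.1 / (G.outDegree e.1 : ℝ)).sum := by
  rw [sum_inEdges G fun u => x u / (G.outDegree u : ℝ)]
  refine Finset.sum_congr rfl fun u _ => ?_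
  simp only [walkMatrix, Matrix.of_apply]
  ring

/-- Each column of the walk matrix sums to `1`, as every out-degree is positive. Hence its Perron
eigenvalue is `1`. -/
theorem sum_walkMatrix_mulVec [Fintype V] {G : DirMultigraph V} (hG : G.StronglyConnected)
    (x : V → ℝ) : ∑ v, (G.walkMatrix *ᵥ x) v = ∑ v, x v := by
  simp only [Matrix.mulVec, dotProduct, walkMatrix, Matrix.of_apply]
  rw [Finset.sum_comm]
  refine Finset.sum_congr rfl fun u _ => ?_
  obtain ⟨v, hv⟩ := hG.exists_edge u
  have h : (G.outDegree u : ℝ) ≠ 0 := Nat.cast_ne_zero.2 (outDegree_pos_of_mem hv).ne'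
  rw [← Finset.sum_mul, ← Finset.sum_div, ← Nat.cast_sum, sum_mult, div_self h, one_mul]

theorem katzPrestigeSystem_iff [Fintype V] {G : DirMultigraph V} {b : V → ℝ≥0} {x : V → ℝ} :
    katzPrestigeSystem V G b x ↔ ∑ v, x v = 1 ∧ G.walkMatrix *ᵥ x = (1 : ℝ) • x := by
  rw [katzPrestigeSystem, and_comm, funext_iff]
  refine and_congr_right fun _ => forall_congr' fun v => ?_
  rw [walkMatrix_mulVec, one_smul, eq_comm]

theorem definesCentralityOn_katzPrestigeSystem :
    DefinesCentralityOn.{u} scGraphs katzPrestigeSystem := by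
  intro V _ _ G b (hG : G.StronglyConnected)
  obtain ⟨r, y, -, hpos, hsum, hr, -, huniq⟩ := hG.perronFrobenius (M := G.walkMatrix)
    (fun v u => div_nonneg (Nat.cast_nonneg _) (Nat.cast_nonneg _))
    (fun u v h => div_pos (Nat.cast_pos.2 (Multiset.count_pos.2 h))
      (Nat.cast_pos.2 (outDegree_pos_of_mem h)))
  have hr1 : r = 1 := by
    have := sum_walkMatrix_mulVec hG y
    simpa [hr, ← Finset.mul_sum, hsum] using this
  subst hr1
  simp only [katzPrestigeSystem_iff]
  refine ⟨⟨y, ⟨hsum, hr⟩, fun x hx => huniq x hx.1 hx.2⟩, fun x hx v => ?_⟩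
  rw [huniq x hx.1 hx.2]
  exact (hpos v).le

/-- Systems `x = a A x + c` with `c` nonnegative are well posed when `lam < 1 / a`. -/
theorem existsUnique_and_nonneg_of_lam_lt [Fintype V] {G : DirMultigraph V} {a : ℝ} (ha : 0 < a)
    (hG : G.lam < 1 / a) {c : V → ℝ} (hc : ∀ v, 0 ≤ c v) {S : (V → ℝ) → Prop}
    (hS : ∀ x, S x ↔ ∀ v, x v = a * (G.adjMatrix *ᵥ x) v + c v) :
    (∃! x, S x) ∧ ∀ x, S x → ∀ v, 0 ≤ x v := by
  have h := hasStrictSupersolution_of_lam_lt hG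
  have key : ∀ x, S x ↔ (1 / a) • x = G.adjMatrix *ᵥ x + (1 / a) • c := fun x => by
    rw [hS, funext_iff]
    refine forall_congr' fun v => ?_
    simp only [Pi.smul_apply, Pi.add_apply, smul_eq_mul]
    field_simp
  simp only [key]
  refine ⟨h.existsUnique G.adjMatrix_nonneg _, fun x hx => ?_⟩
  refine h.nonneg G.adjMatrix_nonneg fun v => ?_
  have h1 := congrFun hx v
  simp only [Pi.smul_apply, Pi.add_apply, smul_eq_mul] at h1
  rw [h1]
  exact le_add_of_nonneg_right (mul_nonneg (one_div_pos.2 ha).le (hc v))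

theorem definesCentralityOn_katzSystem {a : ℝ} (ha : 0 < a) :
    DefinesCentralityOn.{u} (katzGraphs a) (katzSystem a) := by
  intro V _ _ G b hG
  refine existsUnique_and_nonneg_of_lam_lt ha hG (c := fun v => b v) (fun v => (b v).2) fun x => ?_
  simp only [adjMatrix_mulVec]
  rfl

theorem definesCentralityOn_bonacichSystem {a : ℝ} (ha : 0 < a) :
    DefinesCentralityOn.{u} (katzGraphs a) (bonacichSystem a) := by
  intro V _ _ G b hG
  refine existsUnique_and_nonneg_of_lam_lt ha hG (c := G.adjMatrix *ᵥ fun v => b v)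
    (Matrix.mulVec_nonneg_of_nonneg G.adjMatrix_nonneg fun v => (b v).2) fun x => ?_
  simp only [adjMatrix_mulVec, bonacichSystem, Multiset.sum_map_add, Multiset.sum_map_mul_left]

theorem DefinesCentralityOn.solution_spec {C : GraphClass.{u}} {S : CentralitySystem.{u}}
    (h : DefinesCentralityOn C S) [Fintype V] {G : DirMultigraph V} (b : V → ℝ≥0)
    (hG : C V G) : S V G b (S.solution V G b) :=
  Classical.epsilon_spec (h V G b hG).1.exists

theorem DefinesCentralityOn.solution_eq {C : GraphClass.{u}} {S : CentralitySystem.{u}}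
    (h : DefinesCentralityOn C S) [Fintype V] {G : DirMultigraph V} {b : V → ℝ≥0}
    (hG : C V G) {x : V → ℝ} (hx : S V G b x) : x = S.solution V G b :=
  (h V G b hG).1.unique hx (h.solution_spec b hG)

end Systems

/-! ### Invariance under edge swaps -/

section Swap

variable {G : DirMultigraph V} {u u' w w' : V}

theorem exists_edges_eq_add (h : ({(u, u'), (w, w')} : Multiset (V × V)) ≤ G.edges) :
    ∃ E, G.edges = E + {(u, u'), (w, w')} ∧
      (G.swap u u' w w').edges = E + {(u, w'), (w, u')} :=
  ⟨_, (tsub_add_cancel_of_le h).symm, rfl⟩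

theorem outDegree_swap (h : ({(u, u'), (w, w')} : Multiset (V × V)) ≤ G.edges) (v : V) :
    (G.swap u u' w w').outDegree v = G.outDegree v := by
  obtain ⟨E, h1, h2⟩ := exists_edges_eq_add h
  simp only [outDegree, outEdges, h1, h2, Multiset.filter_add, Multiset.card_add,
    Multiset.insert_eq_cons, Multiset.filter_cons, Multiset.filter_singleton]
  split_ifs <;> simp

/-- Each target only exchanges a contribution `f u` for `f w` or conversely. -/
theorem sum_inEdges_swap (h : ({(u, u'), (w, w')} : Multiset (V × V)) ≤ G.edges) {f : V → ℝ}
    (hf : f u = f w) (v : V) :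
    (((G.swap u u' w w').inEdges v).map fun e => f e.1).sum =
      ((G.inEdges v).map fun e => f e.1).sum := by
  obtain ⟨E, h1, h2⟩ := exists_edges_eq_add h
  simp only [inEdges, h1, h2, Multiset.filter_add, Multiset.map_add, Multiset.sum_add,
    Multiset.insert_eq_cons, Multiset.filter_cons, Multiset.filter_singleton]
  split_ifs <;> simp [hf]

theorem edgeSwapOn_degreeCentrality : EdgeSwapOn.{u} allGraphs degreeCentrality := by
  intro V _ _ G b u u' w w' _ h _ _ _ v
  simpa [degreeCentrality] using (sum_inEdges_swap h (f := fun _ => 1) rfl v).symm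

theorem edgeSwapOn_betaMeasure : EdgeSwapOn.{u} allGraphs betaMeasure := by
  intro V _ _ G b u u' w w' _ h _ hd _ v
  simp only [betaMeasure, outDegree_swap h]
  exact (sum_inEdges_swap h (f := fun u => 1 / (G.outDegree u : ℝ)) (by rw [hd]) v).symm

/-- By uniqueness on the swapped graph, it suffices that the old solution satisfies the new system.
-/
theorem DefinesCentralityOn.edgeSwapOn_solution {C : GraphClass.{u}} {S : CentralitySystem.{u}}
    (hS : DefinesCentralityOn C S)
    (hswap : ∀ (V : Type u) [Fintype V] [DecidableEq V] (G : DirMultigraph V) (b : V → ℝ≥0)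
      (u u' w w' : V) (x : V → ℝ), C V G → C V (G.swap u u' w w') →
      ({(u, u'), (w, w')} : Multiset (V × V)) ≤ G.edges → G.outDegree u = G.outDegree w →
      x u = x w → S V G b x → S V (G.swap u u' w w') b x) :
    EdgeSwapOn C S.solution := by
  intro V _ _ G b u u' w w' hG h hF hd hG' v
  exact congrFun (hS.solution_eq hG'
    (hswap V G b u u' w w' _ hG hG' h hd hF (hS.solution_spec b hG))) v

theorem edgeSwapOn_katzCentrality {a : ℝ} (ha : 0 < a) :
    EdgeSwapOn.{u} (katzGraphs a) (katzCentrality a) := by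
  refine (definesCentralityOn_katzSystem ha).edgeSwapOn_solution ?_
  intro V _ _ G b u u' w w' x _ _ h _ hx hS v
  rw [sum_inEdges_swap h hx]
  exact hS v

theorem edgeSwapOn_katzPrestige : EdgeSwapOn.{u} scGraphs katzPrestige := by
  refine definesCentralityOn_katzPrestigeSystem.edgeSwapOn_solution ?_
  intro V _ _ G b u u' w w' x _ _ h hd hx hS
  refine ⟨fun v => ?_, hS.2⟩
  simp only [outDegree_swap h]
  rw [sum_inEdges_swap h (f := fun u => x u / (G.outDegree u : ℝ)) (by rw [hd, hx])]
  exact hS.1 v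

/-- The positive vector `x` has the same image under both adjacency matrices, and a positive
eigenvector determines `lam`. -/
theorem lam_swap_eq [Fintype V] {b : V → ℝ≥0} (hG : G.StronglyConnected)
    (h : ({(u, u'), (w, w')} : Multiset (V × V)) ≤ G.edges) {x : V → ℝ} (hx : x u = x w)
    (hS : eigenvectorSystem V G b x) (hG' : (G.swap u u' w w').StronglyConnected) :
    (G.swap u u' w w').lam = G.lam := by
  obtain ⟨hsum, hr⟩ := (eigenvectorSystem_iff hG).1 hS
  obtain ⟨y, -, hpos, -, -, -, huniq⟩ := hG.lam_spec
  refine hG'.lam_eq (x := x) (huniq x hsum hr ▸ hpos) ?_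
  rw [← hr]
  ext v
  rw [adjMatrix_mulVec, adjMatrix_mulVec, sum_inEdges_swap h hx]

theorem edgeSwapOn_eigenvectorCentrality : EdgeSwapOn.{u} scGraphs eigenvectorCentrality := by
  refine definesCentralityOn_eigenvectorSystem.edgeSwapOn_solution ?_
  intro V _ _ G b u u' w w' x hG hG' h _ hx hS
  refine ⟨fun v => ?_, hS.2⟩
  rw [sum_inEdges_swap h hx, lam_swap_eq hG h hx hS hG']
  exact hS.1 v

end Swap

/-! ### Computing short and infinite distances -/

section Distance

variable {V : Type u} {G : DirMultigraph V} {s t v : V}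

theorem hasPath_one (h : (s, t) ∈ G.edges) : G.HasPath 1 s t :=
  ⟨![s, t], rfl, rfl, fun i => by fin_cases i; exact h⟩

theorem hasPath_two (h : (s, v) ∈ G.edges) (h' : (v, t) ∈ G.edges) : G.HasPath 2 s t :=
  ⟨![s, v, t], rfl, rfl, fun i => by fin_cases i; exacts [h, h']⟩

theorem HasPath.mem_edges (h : G.HasPath 1 s t) : (s, t) ∈ G.edges := by
  obtain ⟨p, rfl, rfl, hp⟩ := h
  exact hp 0

theorem dist_eq_one (h : (s, t) ∈ G.edges) : G.dist s t = 1 := by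
  refine le_antisymm (sInf_le ⟨1, le_rfl, hasPath_one h, rfl⟩) (le_sInf ?_)
  rintro _ ⟨n, hn, -, rfl⟩
  exact_mod_cast hn

theorem dist_eq_two (h0 : (s, t) ∉ G.edges) (h : (s, v) ∈ G.edges) (h' : (v, t) ∈ G.edges) :
    G.dist s t = 2 := by
  refine le_antisymm (sInf_le ⟨2, one_le_two, hasPath_two h h', rfl⟩) (le_sInf ?_)
  rintro _ ⟨n, hn, hp, rfl⟩
  have : n ≠ 1 := by
    rintro rfl
    exact h0 hp.mem_edges
  exact_mod_cast (show 2 ≤ n by omega)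

/-- Nodes outside a set closed under outgoing edges are not reached from inside. -/
theorem dist_eq_top (P : V → Prop) (hP : ∀ e ∈ G.edges, P e.1 → P e.2) (hs : P s) (ht : ¬ P t) :
    G.dist s t = ⊤ := by
  refine sInf_eq_top.2 ?_
  rintro _ ⟨n, -, ⟨p, rfl, rfl, hp⟩, rfl⟩
  refine absurd ?_ ht
  have : ∀ i, P (p i) := fun i => by
    induction i using Fin.induction with
    | zero => exact hs
    | succ i ih => exact hP _ (hp i) ih
  exact this _

end Distance

/-! ### Counterexamples -/

section Counterexamples

/-- The edges `0 → 2` and `1 → 3`. -/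
def parallelEdges : DirMultigraph (ULift.{u} (Fin 4)) := ⟨{(⟨0⟩, ⟨2⟩), (⟨1⟩, ⟨3⟩)}⟩

/-- For `c > 0`, an eigenvector vanishes at the sources `0` and `1`, which have no incoming edges,
and then at their targets. -/
theorem lam_le_zero_of_parallel {i j : Fin 4} (h : ({i, j} : Finset (Fin 4)) = {2, 3}) :
    DirMultigraph.lam (V := ULift.{u} (Fin 4)) ⟨{(⟨0⟩, ⟨i⟩), (⟨1⟩, ⟨j⟩)}⟩ ≤ 0 := by
  have hij : (i = 2 ∧ j = 3) ∨ (i = 3 ∧ j = 2) := by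
    revert i j; decide
  refine Real.sSup_le ?_ le_rfl
  rintro c ⟨x, hx, hc⟩
  by_contra! hc0
  refine hx ?_
  have key : ∀ v, c * x v = _ := fun v =>
    (congrFun hc v).symm.trans (adjMatrix_mulVec _ x v)
  have h0 : x ⟨0⟩ = 0 := by
    have := key ⟨0⟩
    rcases hij with ⟨rfl, rfl⟩ | ⟨rfl, rfl⟩ <;>
      simpa [inEdges, Multiset.filter_cons, Multiset.filter_singleton, hc0.ne'] using this
  have h1 : x ⟨1⟩ = 0 := by
    have := key ⟨1⟩
    rcases hij with ⟨rfl, rfl⟩ | ⟨rfl, rfl⟩ <;>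
      simpa [inEdges, Multiset.filter_cons, Multiset.filter_singleton, hc0.ne'] using this
  ext ⟨v⟩
  have := key ⟨v⟩
  rcases hij with ⟨rfl, rfl⟩ | ⟨rfl, rfl⟩ <;> fin_cases v <;>
    simpa [inEdges, Multiset.filter_cons, Multiset.filter_singleton, hc0.ne', h0, h1] using this

theorem swap_parallelEdges :
    parallelEdges.{u}.swap ⟨0⟩ ⟨2⟩ ⟨1⟩ ⟨3⟩ = ⟨{(⟨0⟩, ⟨3⟩), (⟨1⟩, ⟨2⟩)}⟩ := by
  simp [swap, parallelEdges]

/-- Only node `0` has weight, yet nodes `0` and `1` both have centrality `0`. Node `2` gets `1` from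
node `0` before the swap and `0` from node `1` after it. -/
theorem not_edgeSwapOn_bonacichCentrality {a : ℝ} (ha : 0 < a) :
    ¬ EdgeSwapOn.{u} (katzGraphs a) (bonacichCentrality a) := by
  intro h
  have ha' : 0 < 1 / a := one_div_pos.2 ha
  have hG : katzGraphs a _ parallelEdges.{u} := (lam_le_zero_of_parallel rfl).trans_lt ha'
  have hG' : katzGraphs a _ (parallelEdges.{u}.swap ⟨0⟩ ⟨2⟩ ⟨1⟩ ⟨3⟩) := by
    rw [swap_parallelEdges]
    exact (lam_le_zero_of_parallel (by decide)).trans_lt ha'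
  let b : ULift.{u} (Fin 4) → ℝ≥0 := fun i => if i.down = 0 then 1 else 0
  have hx := (definesCentralityOn_bonacichSystem ha).solution_spec b hG
  have hy := (definesCentralityOn_bonacichSystem ha).solution_spec b hG'
  have hF := h _ parallelEdges.{u} b ⟨0⟩ ⟨2⟩ ⟨1⟩ ⟨3⟩ hG le_rfl
  rw [swap_parallelEdges] at hF hG' hy
  change bonacichSystem a _ _ b (bonacichCentrality a _ parallelEdges b) at hx
  change bonacichSystem a _ _ b (bonacichCentrality a _ _ b) at hy
  generalize bonacichCentrality a _ parallelEdges b = x at hx hF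
  generalize bonacichCentrality a _ _ b = y at hy hF
  have hx0 := hx ⟨0⟩
  have hx1 := hx ⟨1⟩
  have hx2 := hx ⟨2⟩
  have hy1 := hy ⟨1⟩
  have hy2 := hy ⟨2⟩
  simp [parallelEdges, inEdges, Multiset.filter_singleton, b]
    at hx0 hx1 hx2 hy1 hy2
  have := hF (by rw [hx0, hx1]) (by decide) hG' ⟨2⟩
  rw [hx2, hy2, hx0, hy1] at this
  simp at this

/-- A loop at each of two nodes. -/
def twoLoops : DirMultigraph (ULift.{u} (Fin 2)) := ⟨{(⟨0⟩, ⟨0⟩), (⟨1⟩, ⟨1⟩)}⟩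

/-- Swapping the loops creates a 2-cycle, raising the centrality of node `0` from `0` to `a`. -/
theorem not_edgeSwapOn_decayCentrality {a : ℝ} (ha : 0 < a) :
    ¬ EdgeSwapOn.{u} allGraphs (decayCentrality a) := by
  intro h
  have e0 : Finset.univ.erase (⟨0⟩ : ULift.{u} (Fin 2)) = {⟨1⟩} := by decide
  have e1 : Finset.univ.erase (⟨1⟩ : ULift.{u} (Fin 2)) = {⟨0⟩} := by decide
  have d0 : twoLoops.{u}.dist ⟨1⟩ ⟨0⟩ = ⊤ := dist_eq_top (· = ⟨1⟩) (by decide) rfl (by decide)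
  have d1 : twoLoops.{u}.dist ⟨0⟩ ⟨1⟩ = ⊤ := dist_eq_top (· = ⟨0⟩) (by decide) rfl (by decide)
  have d2 : (twoLoops.{u}.swap ⟨0⟩ ⟨0⟩ ⟨1⟩ ⟨1⟩).dist ⟨1⟩ ⟨0⟩ = 1 := dist_eq_one (by decide)
  have := h _ twoLoops.{u} 0 ⟨0⟩ ⟨0⟩ ⟨1⟩ ⟨1⟩ trivial le_rfl
    (by simp [decayCentrality, e0, e1, d0, d1]) (by decide) trivial ⟨0⟩
  simp [decayCentrality, e0, d0, d2] at this
  exact ha.ne this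

/-- The directed triangle with a loop at each node. -/
def loopedTriangle : DirMultigraph (ULift.{u} (Fin 3)) :=
  ⟨{(⟨0⟩, ⟨0⟩), (⟨1⟩, ⟨2⟩), (⟨0⟩, ⟨1⟩), (⟨1⟩, ⟨1⟩), (⟨2⟩, ⟨0⟩), (⟨2⟩, ⟨2⟩)}⟩

theorem stronglyConnected_of_diameter_le_two {V : Type u} [Fintype V] [Nonempty V]
    {G : DirMultigraph V}
    (h : ∀ s t, (s, t) ∈ G.edges ∨ ∃ v, (s, v) ∈ G.edges ∧ (v, t) ∈ G.edges) :
    G.StronglyConnected :=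
  ⟨‹_›, fun s t => (h s t).elim (fun h => ⟨1, le_rfl, hasPath_one h⟩)
    fun ⟨_, h, h'⟩ => ⟨2, one_le_two, hasPath_two h h'⟩⟩

/-- Nodes `0` and `1` both have distance sum `3`. Trading the loop at `0` and `1 → 2` for `0 → 2`
and `1 → 0` lowers the sum for `0` to `2`. -/
theorem not_edgeSwapOn_closenessCentrality : ¬ EdgeSwapOn.{u} scGraphs closenessCentrality := by
  intro h
  have e0 : Finset.univ.erase (⟨0⟩ : ULift.{u} (Fin 3)) = {⟨1⟩, ⟨2⟩} := by decide
  have e1 : Finset.univ.erase (⟨1⟩ : ULift.{u} (Fin 3)) = {⟨0⟩, ⟨2⟩} := by decide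
  have d10 : loopedTriangle.{u}.dist ⟨1⟩ ⟨0⟩ = 2 :=
    dist_eq_two (v := ⟨2⟩) (by decide) (by decide) (by decide)
  have d20 : loopedTriangle.{u}.dist ⟨2⟩ ⟨0⟩ = 1 := dist_eq_one (by decide)
  have d01 : loopedTriangle.{u}.dist ⟨0⟩ ⟨1⟩ = 1 := dist_eq_one (by decide)
  have d21 : loopedTriangle.{u}.dist ⟨2⟩ ⟨1⟩ = 2 :=
    dist_eq_two (v := ⟨0⟩) (by decide) (by decide) (by decide)
  have d10' : (loopedTriangle.{u}.swap ⟨0⟩ ⟨0⟩ ⟨1⟩ ⟨2⟩).dist ⟨1⟩ ⟨0⟩ = 1 :=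
    dist_eq_one (by decide)
  have d20' : (loopedTriangle.{u}.swap ⟨0⟩ ⟨0⟩ ⟨1⟩ ⟨2⟩).dist ⟨2⟩ ⟨0⟩ = 1 :=
    dist_eq_one (by decide)
  have := h _ loopedTriangle.{u} 0 ⟨0⟩ ⟨0⟩ ⟨1⟩ ⟨2⟩
    (stronglyConnected_of_diameter_le_two (by decide)) (by decide)
    (by simp [closenessCentrality, e0, e1, d10, d20, d01, d21, add_comm]) (by decide)
    (stronglyConnected_of_diameter_le_two (by decide)) ⟨0⟩
  simp [closenessCentrality, e0, d10, d20, d10', d20'] at this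

/-- A loop at each of the nodes `0` and `1`, and the edge `2 → 0`. -/
def loopsWithTail : DirMultigraph (ULift.{u} (Fin 3)) :=
  ⟨{(⟨0⟩, ⟨0⟩), (⟨1⟩, ⟨1⟩), (⟨2⟩, ⟨0⟩)}⟩

theorem betweenness_fin_three (G : DirMultigraph (ULift.{u} (Fin 3)))
    (b : ULift.{u} (Fin 3) → ℝ≥0) {v s t : ULift.{u} (Fin 3)}
    (hst : (Finset.univ.erase v).erase t = {s}) (hts : (Finset.univ.erase v).erase s = {t})
    (hne : s ≠ t) : betweennessCentrality _ G b v =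
      (G.numShortestPathsThrough s t v : ℝ) / (G.numShortestPaths s t : ℝ) +
      (G.numShortestPathsThrough t s v : ℝ) / (G.numShortestPaths t s : ℝ) := by
  have ht : t ∈ Finset.univ.erase v :=
    Finset.mem_of_mem_erase (hts ▸ Finset.mem_singleton_self t)
  have he : Finset.univ.erase v = {s, t} := by
    rw [← Finset.insert_erase ht, hst, Finset.pair_comm]
  -- The guard is redundant because division by zero yields `0`.
  have hif : ∀ p q : ℕ, (if q ≠ 0 then (p : ℝ) / (q : ℝ) else 0) = (p : ℝ) / (q : ℝ) := by
    intro p q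
    split_ifs with h
    · rfl
    · simp [not_not.1 h]
  rw [betweennessCentrality]
  simp only [hif]
  rw [Finset.sum_congr he fun _ _ => rfl, Finset.sum_pair hne, hst, hts, Finset.sum_singleton,
    Finset.sum_singleton]

/-- Before the swap no shortest path between other nodes visits `0` or `1`. Afterwards `2 → 0 → 1`
is the only shortest path from `2` to `1`, so node `0` scores `1`. -/
theorem not_edgeSwapOn_betweennessCentrality :
    ¬ EdgeSwapOn.{u} allGraphs betweennessCentrality := by
  intro h
  have d01 : loopsWithTail.{u}.dist ⟨0⟩ ⟨1⟩ = ⊤ :=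
    dist_eq_top (· = ⟨0⟩) (by decide) rfl (by decide)
  have d02 : loopsWithTail.{u}.dist ⟨0⟩ ⟨2⟩ = ⊤ :=
    dist_eq_top (· = ⟨0⟩) (by decide) rfl (by decide)
  have d12 : loopsWithTail.{u}.dist ⟨1⟩ ⟨2⟩ = ⊤ :=
    dist_eq_top (· = ⟨1⟩) (by decide) rfl (by decide)
  have d21 : loopsWithTail.{u}.dist ⟨2⟩ ⟨1⟩ = ⊤ :=
    dist_eq_top (· ≠ ⟨1⟩) (by decide) (by decide) (by decide)
  have d20 : loopsWithTail.{u}.dist ⟨2⟩ ⟨0⟩ = 1 := dist_eq_one (by decide)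
  have n20 : loopsWithTail.{u}.numPathsThrough 1 ⟨2⟩ ⟨0⟩ ⟨1⟩ = 0 := by decide
  have d12' : (loopsWithTail.{u}.swap ⟨0⟩ ⟨0⟩ ⟨1⟩ ⟨1⟩).dist ⟨1⟩ ⟨2⟩ = ⊤ :=
    dist_eq_top (· ≠ ⟨2⟩) (by decide) (by decide) (by decide)
  have d21' : (loopsWithTail.{u}.swap ⟨0⟩ ⟨0⟩ ⟨1⟩ ⟨1⟩).dist ⟨2⟩ ⟨1⟩ = 2 :=
    dist_eq_two (v := ⟨0⟩) (by decide) (by decide) (by decide)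
  have n21 : (loopsWithTail.{u}.swap ⟨0⟩ ⟨0⟩ ⟨1⟩ ⟨1⟩).numPathsThrough 2 ⟨2⟩ ⟨1⟩ ⟨0⟩ = 1 := by
    decide
  have n21' : (loopsWithTail.{u}.swap ⟨0⟩ ⟨0⟩ ⟨1⟩ ⟨1⟩).numPaths 2 ⟨2⟩ ⟨1⟩ = 1 := by
    decide
  have b0 : betweennessCentrality _ loopsWithTail.{u} 0 ⟨0⟩ = 0 := by
    rw [betweenness_fin_three _ _ (s := ⟨1⟩) (t := ⟨2⟩) (by decide) (by decide) (by decide)]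
    simp [numShortestPathsThrough, d12, d21]
  have b1 : betweennessCentrality _ loopsWithTail.{u} 0 ⟨1⟩ = 0 := by
    rw [betweenness_fin_three _ _ (s := ⟨0⟩) (t := ⟨2⟩) (by decide) (by decide) (by decide)]
    simp [numShortestPathsThrough, d02, d20, n20]
  have b0' : betweennessCentrality _ (loopsWithTail.{u}.swap ⟨0⟩ ⟨0⟩ ⟨1⟩ ⟨1⟩) 0 ⟨0⟩ = 1 := by
    rw [betweenness_fin_three _ _ (s := ⟨1⟩) (t := ⟨2⟩) (by decide) (by decide) (by decide)]
    simp [numShortestPathsThrough, numShortestPaths, d12', d21', n21, n21']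
  have := h _ loopsWithTail.{u} 0 ⟨0⟩ ⟨0⟩ ⟨1⟩ ⟨1⟩ trivial (by decide) (b0.trans b1.symm)
    (by decide) trivial ⟨0⟩
  rw [b0, b0'] at this
  exact zero_ne_one this

end Counterexamples

end DirMultigraph

theorem mainTheorem8 :
    -- the centralities given by equations are well defined on their classes
    (DirMultigraph.DefinesCentralityOn.{u} DirMultigraph.scGraphs
        DirMultigraph.eigenvectorSystem ∧
      DirMultigraph.DefinesCentralityOn.{u} DirMultigraph.scGraphs
        DirMultigraph.katzPrestigeSystem ∧
      ∀ a : ℝ, 0 < a → a < 1 →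
        DirMultigraph.DefinesCentralityOn.{u} (DirMultigraph.katzGraphs a)
            (DirMultigraph.katzSystem a) ∧
          DirMultigraph.DefinesCentralityOn.{u} (DirMultigraph.katzGraphs a)
            (DirMultigraph.bonacichSystem a)) ∧
    -- Edge Swap holds
    (DirMultigraph.EdgeSwapOn.{u} DirMultigraph.allGraphs DirMultigraph.degreeCentrality ∧
      DirMultigraph.EdgeSwapOn.{u} DirMultigraph.allGraphs DirMultigraph.betaMeasure ∧
      DirMultigraph.EdgeSwapOn.{u} DirMultigraph.scGraphs DirMultigraph.eigenvectorCentrality ∧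
      DirMultigraph.EdgeSwapOn.{u} DirMultigraph.scGraphs DirMultigraph.katzPrestige ∧
      ∀ a : ℝ, 0 < a → a < 1 →
        DirMultigraph.EdgeSwapOn.{u} (DirMultigraph.katzGraphs a)
          (DirMultigraph.katzCentrality a)) ∧
    -- Edge Swap fails
    ((∀ a : ℝ, 0 < a → a < 1 →
        ¬ DirMultigraph.EdgeSwapOn.{u} (DirMultigraph.katzGraphs a)
            (DirMultigraph.bonacichCentrality a)) ∧
      ¬ DirMultigraph.EdgeSwapOn.{u} DirMultigraph.scGraphs
          DirMultigraph.closenessCentrality ∧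
      (∀ a : ℝ, 0 < a → a < 1 →
        ¬ DirMultigraph.EdgeSwapOn.{u} DirMultigraph.allGraphs
            (DirMultigraph.decayCentrality a)) ∧
      ¬ DirMultigraph.EdgeSwapOn.{u} DirMultigraph.allGraphs
          DirMultigraph.betweennessCentrality) ∧
    -- a positive solution of the eigen-equation belongs to the largest eigenvalue
    (∀ (V : Type u) [Fintype V] [DecidableEq V] (G : DirMultigraph V) (c : ℝ) (x : V → ℝ),
      G.StronglyConnected → (∀ v, 0 < x v) → G.adjMatrix *ᵥ x = c • x → G.lam = c) ∧
    -- the largest eigenvalue does not change in the eigenvector case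
    (∀ (V : Type u) [Fintype V] [DecidableEq V] (G : DirMultigraph V) (b : V → ℝ≥0)
      (u u' w w' : V),
      G.StronglyConnected → ({(u, u'), (w, w')} : Multiset (V × V)) ≤ G.edges →
      DirMultigraph.eigenvectorCentrality V G b u =
        DirMultigraph.eigenvectorCentrality V G b w →
      G.outDegree u = G.outDegree w →
      (G.swap u u' w w').StronglyConnected →
      G.lam = (G.swap u u' w w').lam) := by
  refine ⟨⟨DirMultigraph.definesCentralityOn_eigenvectorSystem,
      DirMultigraph.definesCentralityOn_katzPrestigeSystem, fun a ha _ =>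
        ⟨DirMultigraph.definesCentralityOn_katzSystem ha,
          DirMultigraph.definesCentralityOn_bonacichSystem ha⟩⟩,
    ⟨DirMultigraph.edgeSwapOn_degreeCentrality, DirMultigraph.edgeSwapOn_betaMeasure,
      DirMultigraph.edgeSwapOn_eigenvectorCentrality, DirMultigraph.edgeSwapOn_katzPrestige,
      fun a ha _ => DirMultigraph.edgeSwapOn_katzCentrality ha⟩,
    ⟨fun a ha _ => DirMultigraph.not_edgeSwapOn_bonacichCentrality ha,
      DirMultigraph.not_edgeSwapOn_closenessCentrality,
      fun a ha _ => DirMultigraph.not_edgeSwapOn_decayCentrality ha,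
      DirMultigraph.not_edgeSwapOn_betweennessCentrality⟩,
    fun V _ _ G c x hG hx hc => hG.lam_eq hx hc,
    fun V _ _ G b u u' w w' hG h hF _ hG' => ?_⟩
  exact (DirMultigraph.lam_swap_eq hG h hF
    (DirMultigraph.definesCentralityOn_eigenvectorSystem.solution_spec b hG) hG').symm
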